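/- Let $(M,g)$ be a smooth Lorentzian manifold of dimension $n\ge 3$ (signature $(-,+,\dots,+)$) that is a generalized Robertson–Walker (GRW) manifold, i.e. that carries a Chen vector $X$: a smooth vector field with $X^2:=X_jX^j<0$ everywhere and $\nabla_jX_k=\rho\,g_{jk}$ for some smooth scalar field $\rho$, where $\nabla$ is the Levi-Civita connection. With the conventions $[\nabla_i,\nabla_j]V_k=R_{ijk}{}^{m}V_m$, $R_{kl}=-g^{jm}R_{jklm}$, $R=g^{kl}R_{kl}$, let $$C_{jklm}=R_{jklm}+\frac{1}{n-2}\left(g_{jm}R_{kl}-g_{km}R_{jl}+R_{jm}g_{kl}-R_{km}g_{jl}\right)-R\,\frac{g_{jm}g_{kl}-g_{jl}g_{km}}{(n-1)(n-2)}$$ be the Weyl tensor, and let $$\mathsf C_{jk}=C_{ajkb}\frac{X^aX^b}{X^2}.$$ Then, at every point and in the coordinates of every smooth chart, $$C_{jklm}X^m=X_j\,\mathsf C_{kl}-X_k\,\mathsf C_{jl}\qquad\text{for all } j,k,l.$$ Consequently, at every point, $C_{jklm}X^m=0$ for all $j,k,l$ if and only if $\mathsf C_{kl}=0$ for all $k,l$.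 -/

import Mathlib

open scoped Manifold ContDiff

noncomputable section

namespace GRW

/-- The model space `ℝⁿ` of an `n`-dimensional manifold. -/
abbrev Model (n : ℕ) : Type := EuclideanSpace ℝ (Fin n)

/-- A symmetric bilinear form on an `n`-dimensional real vector space is *Lorentzian* if it is
`diag(-1, 1, …, 1)` in some basis. -/
def IsLorentzForm {n : ℕ} {V : Type*} [AddCommGroup V] [Module ℝ V] (B : V → V → ℝ) : Prop :=
  ∃ b : Module.Basis (Fin n) ℝ V, ∀ i j : Fin n,
    B (b i) (b j) = if i = j then (if (i : ℕ) = 0 then -1 else 1) else 0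

/-- A smooth Lorentzian metric on a smooth `n`-dimensional manifold `M`: a smooth section of the
bundle of bilinear forms on the tangent spaces, symmetric and of signature `(-, +, …, +)` at
every point. -/
structure LorentzMetric (n : ℕ) (M : Type*) [TopologicalSpace M] [ChartedSpace (Model n) M]
    [IsManifold 𝓘(ℝ, Model n) ∞ M] where
  val : ∀ p : M, TangentSpace 𝓘(ℝ, Model n) p →L[ℝ] TangentSpace 𝓘(ℝ, Model n) p →L[ℝ] ℝ
  symm : ∀ (p : M) (v w : TangentSpace 𝓘(ℝ, Model n) p), val p v w = val p w v
  lorentz : ∀ p : M, IsLorentzForm (n := n) (fun v w => val p v w)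
  contMDiff : ContMDiff 𝓘(ℝ, Model n)
    (𝓘(ℝ, Model n).prod 𝓘(ℝ, Model n →L[ℝ] Model n →L[ℝ] ℝ)) ∞
    (fun p => Bundle.TotalSpace.mk' (Model n →L[ℝ] Model n →L[ℝ] ℝ)
      (E := fun p : M =>
        TangentSpace 𝓘(ℝ, Model n) p →L[ℝ] TangentSpace 𝓘(ℝ, Model n) p →L[ℝ] ℝ) p (val p))

/-- The partial derivative `∂ᵢ f` of a function of `n` real variables. -/
def pd {n : ℕ} (i : Fin n) (f : Model n → ℝ) (y : Model n) : ℝ :=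
  fderiv ℝ f y (EuclideanSpace.single i 1)

variable {n : ℕ} {M : Type*} [TopologicalSpace M] [ChartedSpace (Model n) M]
  [IsManifold 𝓘(ℝ, Model n) ∞ M]

/-- The coordinate vector field `∂ᵢ` of the chart `e`, at the point with coordinates `y`. -/
def coordVec (e : OpenPartialHomeomorph M (Model n)) (y : Model n) (i : Fin n) :
    TangentSpace 𝓘(ℝ, Model n) (e.symm y) :=
  mfderiv 𝓘(ℝ, Model n) 𝓘(ℝ, Model n) e.symm y
    (EuclideanSpace.single i 1 : Model n)

/-- The contravariant components `Xᵐ` of a vector field in the chart `e`. -/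
def vecUp (e : OpenPartialHomeomorph M (Model n))
    (X : ∀ p : M, TangentSpace 𝓘(ℝ, Model n) p) (m : Fin n) (y : Model n) : ℝ :=
  let v : Model n := mfderiv 𝓘(ℝ, Model n) 𝓘(ℝ, Model n) e (e.symm y) (X (e.symm y))
  v m

namespace LorentzMetric

variable (g : LorentzMetric n M) (e : OpenPartialHomeomorph M (Model n))
  (X : ∀ p : M, TangentSpace 𝓘(ℝ, Model n) p)

/-- The components `gᵢⱼ` of the metric in the chart `e`. -/
def comp (i j : Fin n) (y : Model n) : ℝ :=
  g.val (e.symm y) (coordVec e y i) (coordVec e y j)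

/-- The components `gⁱʲ` of the inverse metric. -/
def inv (i j : Fin n) (y : Model n) : ℝ :=
  (Matrix.of fun a b => g.comp e a b y)⁻¹ i j

/-- The Christoffel symbols `Γᵐᵢⱼ` of the Levi-Civita connection. -/
def christoffel (m i j : Fin n) (y : Model n) : ℝ :=
  1 / 2 * ∑ a, g.inv e m a y *
    (pd i (g.comp e j a) y + pd j (g.comp e i a) y - pd a (g.comp e i j) y)

/-- The covariant components `Xⱼ = gⱼₖ Xᵏ` of a vector field. -/
def vecDown (j : Fin n) (y : Model n) : ℝ :=
  ∑ k, g.comp e j k y * vecUp e X k y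

/-- `X² = Xⱼ Xʲ`. -/
def sqNorm (y : Model n) : ℝ := ∑ j, g.vecDown e X j y * vecUp e X j y

/-- The covariant derivative `∇ⱼ Xₖ = ∂ⱼ Xₖ - Γᵐⱼₖ Xₘ`. -/
def covDeriv (j k : Fin n) (y : Model n) : ℝ :=
  pd j (g.vecDown e X k) y - ∑ m, g.christoffel e m j k y * g.vecDown e X m y

/-- The curvature `Rᵢⱼₖᵐ` (last index up), with the sign `[∇ᵢ, ∇ⱼ] Xₖ = Rᵢⱼₖᵐ Xₘ`. -/
def riemannUp (i j k m : Fin n) (y : Model n) : ℝ :=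
  pd j (g.christoffel e m i k) y - pd i (g.christoffel e m j k) y
    + ∑ a, (g.christoffel e a i k y * g.christoffel e m j a y
      - g.christoffel e a j k y * g.christoffel e m i a y)

/-- The Riemann tensor `Rⱼₖₗₘ`. -/
def riemann (j k l m : Fin n) (y : Model n) : ℝ :=
  ∑ a, g.riemannUp e j k l a y * g.comp e a m y

/-- The Ricci tensor `Rₖₗ = - gʲᵐ Rⱼₖₗₘ` (positive on round spheres). -/
def ricci (k l : Fin n) (y : Model n) : ℝ :=
  -∑ j, ∑ m, g.inv e j m y * g.riemann e j k l m y

/-- The scalar curvature `R = gᵏˡ Rₖₗ`. -/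
def scalar (y : Model n) : ℝ :=
  ∑ k, ∑ l, g.inv e k l y * g.ricci e k l y

/-- The Weyl tensor `Cⱼₖₗₘ`. -/
def weyl (j k l m : Fin n) (y : Model n) : ℝ :=
  g.riemann e j k l m y
    + 1 / ((n : ℝ) - 2) *
      (g.comp e j m y * g.ricci e k l y - g.comp e k m y * g.ricci e j l y
        + g.ricci e j m y * g.comp e k l y - g.ricci e k m y * g.comp e j l y)
    - g.scalar e y *
      ((g.comp e j m y * g.comp e k l y - g.comp e j l y * g.comp e k m y)
        / (((n : ℝ) - 1) * ((n : ℝ) - 2)))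

/-- The contraction `Cⱼₖₗₘ Xᵐ`. -/
def weylX (j k l : Fin n) (y : Model n) : ℝ :=
  ∑ m, g.weyl e j k l m y * vecUp e X m y

/-- The contracted Weyl tensor `𝖢ⱼₖ = Cₐⱼₖᵦ Xᵃ Xᵇ / X²`. -/
def contractedWeyl (j k : Fin n) (y : Model n) : ℝ :=
  ∑ a, ∑ b, g.weyl e a j k b y * (vecUp e X a y * vecUp e X b y / g.sqNorm e X y)

/-- `X` is a *Chen vector* of `(M, g)`: a smooth timelike vector field with `∇ⱼ Xₖ = ρ gⱼₖ` in
every smooth chart, for some smooth scalar field `ρ`. A Lorentzian manifold of dimension at least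
three is a generalized Robertson-Walker manifold when it carries such a vector field. -/
structure IsChenVector : Prop where
  contMDiff : ContMDiff 𝓘(ℝ, Model n) (𝓘(ℝ, Model n).prod 𝓘(ℝ, Model n)) ∞
    (fun p => (⟨p, X p⟩ : TangentBundle 𝓘(ℝ, Model n) M))
  timelike : ∀ p : M, g.val p (X p) (X p) < 0
  concircular : ∃ ρ : M → ℝ, ContMDiff 𝓘(ℝ, Model n) 𝓘(ℝ, ℝ) ∞ ρ ∧
    ∀ e ∈ IsManifold.maximalAtlas 𝓘(ℝ, Model n) ∞ M, ∀ y ∈ e.target, ∀ j k : Fin n,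
      g.covDeriv e X j k y = ρ (e.symm y) * g.comp e j k y

end LorentzMetric

end GRW

end

/-! ### Chart components: smoothness, nondegeneracy and the inverse metric. -/

noncomputable section

namespace GRW

variable {n : ℕ} {M : Type*} [TopologicalSpace M] [ChartedSpace (Model n) M]
  {e : OpenPartialHomeomorph M (Model n)}
  {X : ∀ p : M, TangentSpace 𝓘(ℝ, Model n) p}

/-! Commuting derivatives in `∇ⱼXₖ = ρgⱼₖ` gives `RᵢⱼₖₘXᵐ = ∂ᵢρ gⱼₖ - ∂ⱼρ gᵢₖ`. Contracting with
`Xᵏ` kills the left side, so `dρ` is parallel to `X`, say `∂ᵢρ = cXᵢ`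
(`exists_sum_riemann_mul_vecUp`). A trace then makes `X` a Ricci eigenvector
(`sum_ricci_mul_vecUp`). In the Weyl tensor this yields `CⱼₖₗₘXᵐ = XⱼSₖₗ - XₖSⱼₗ`, where `S`
combines Ricci and metric and `SX = sX` (`exists_weylX_eq`). Contracting with `Xʲ/X²` shows that the
contracted Weyl tensor is `Sₖₗ - sXₖXₗ/X²`; the correction disappears on antisymmetrizing, so it may
replace `S`.

The Riemann symmetries used on the way are derived from the coordinate formulas. -/

theorem mdifferentiable_of_mem_maximalAtlas
    (he : e ∈ IsManifold.maximalAtlas 𝓘(ℝ, Model n) ∞ M) :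
    e.MDifferentiable 𝓘(ℝ, Model n) 𝓘(ℝ, Model n) :=
  ⟨(contMDiffOn_of_mem_maximalAtlas he).mdifferentiableOn (by simp),
    (contMDiffOn_symm_of_mem_maximalAtlas he).mdifferentiableOn (by simp)⟩

theorem sum_smul_coordVec (y : Model n) (v : Fin n → ℝ) :
    ∑ i, v i • coordVec e y i =
      mfderiv 𝓘(ℝ, Model n) 𝓘(ℝ, Model n) e.symm y (WithLp.toLp 2 v : Model n) := by
  have h : (WithLp.toLp 2 v : Model n) = ∑ i, v i • (EuclideanSpace.single i 1 : Model n) := by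
    ext j
    simp [Finset.sum_apply, Pi.single_apply]
  rw [h]
  simp only [coordVec]
  erw [map_sum]
  refine Finset.sum_congr rfl fun i _ => ?_
  erw [map_smul]

theorem sum_vecUp_smul_coordVec (he : e ∈ IsManifold.maximalAtlas 𝓘(ℝ, Model n) ∞ M)
    {y : Model n} (hy : y ∈ e.target) :
    ∑ i, vecUp e X i y • coordVec e y i = X (e.symm y) := by
  rw [sum_smul_coordVec]
  have h := (mdifferentiable_of_mem_maximalAtlas he).symm_comp_deriv (e.map_target hy)
  have h' := DFunLike.congr_fun h (X (e.symm y))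
  rw [e.right_inv hy] at h'
  exact h'

variable [IsManifold 𝓘(ℝ, Model n) ∞ M]

/-- The field is the tangent map of `e.symm` composed with a constant section; on the open target
`mfderivWithin` and `mfderiv` agree. -/
theorem contMDiffAt_coordVec (he : e ∈ IsManifold.maximalAtlas 𝓘(ℝ, Model n) ∞ M)
    {y : Model n} (hy : y ∈ e.target) (i : Fin n) :
    ContMDiffAt 𝓘(ℝ, Model n) (𝓘(ℝ, Model n).prod 𝓘(ℝ, Model n)) ∞
      (fun z => (⟨e.symm z, coordVec e z i⟩ : TangentBundle 𝓘(ℝ, Model n) M)) y := by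
  have h1 := (contMDiffOn_symm_of_mem_maximalAtlas he).contMDiffOn_tangentMapWithin
    (m := ∞) (by simp) e.open_target.uniqueMDiffOn
  have h2 : ContMDiffAt 𝓘(ℝ, Model n) (𝓘(ℝ, Model n).prod 𝓘(ℝ, Model n)) ∞
      (fun z => (⟨z, (EuclideanSpace.single i 1 : Model n)⟩ :
        TangentBundle 𝓘(ℝ, Model n) (Model n))) y :=
    contMDiffAt_vectorSpace_iff_contDiffAt.2 contDiffAt_const
  have h3 := (h1.contMDiffAt (x := ⟨y, (EuclideanSpace.single i 1 : Model n)⟩)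
    ((e.open_target.preimage (FiberBundle.continuous_proj _ _)).mem_nhds hy)).comp y h2
  refine h3.congr_of_eventuallyEq ?_
  filter_upwards [e.open_target.mem_nhds hy] with z hz
  simp only [Function.comp, tangentMapWithin]
  rw [mfderivWithin_of_isOpen e.open_target hz]
  rfl

theorem contDiffAt_vecUp (he : e ∈ IsManifold.maximalAtlas 𝓘(ℝ, Model n) ∞ M)
    (hX : ContMDiff 𝓘(ℝ, Model n) (𝓘(ℝ, Model n).prod 𝓘(ℝ, Model n)) ∞
      (fun p => (⟨p, X p⟩ : TangentBundle 𝓘(ℝ, Model n) M)))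
    {y : Model n} (hy : y ∈ e.target) (m : Fin n) :
    ContDiffAt ℝ ∞ (vecUp e X m) y := by
  have h1 := (contMDiffOn_of_mem_maximalAtlas he).contMDiffOn_tangentMapWithin
    (m := ∞) (by simp) e.open_source.uniqueMDiffOn
  have hs := e.map_target hy
  have h2 := hX.contMDiffAt.comp y
    ((contMDiffOn_symm_of_mem_maximalAtlas he).contMDiffAt (e.open_target.mem_nhds hy))
  have h3 := (h1.contMDiffAt (x := ⟨e.symm y, X (e.symm y)⟩)
    ((e.open_source.preimage (FiberBundle.continuous_proj _ _)).mem_nhds hs)).comp y h2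
  have h4 := (contMDiff_snd_tangentBundle_modelSpace (n := ∞) (Model n)
    𝓘(ℝ, Model n)).contMDiffAt.comp y h3
  have h5 := ((EuclideanSpace.proj (𝕜 := ℝ) m).contDiff (n := ∞)).contDiffAt.comp y h4.contDiffAt
  refine h5.congr_of_eventuallyEq ?_
  filter_upwards [e.open_target.mem_nhds hy] with z hz
  simp only [Function.comp, tangentMapWithin]
  rw [mfderivWithin_of_isOpen e.open_source (e.map_target hz)]
  rfl

variable (g : LorentzMetric n M)

namespace LorentzMetric

theorem contDiffAt_comp (he : e ∈ IsManifold.maximalAtlas 𝓘(ℝ, Model n) ∞ M)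
    {y : Model n} (hy : y ∈ e.target) (i j : Fin n) : ContDiffAt ℝ ∞ (g.comp e i j) y := by
  have h1 := g.contMDiff.contMDiffAt.comp y
    ((contMDiffOn_symm_of_mem_maximalAtlas he).contMDiffAt (e.open_target.mem_nhds hy))
  have h2 := ContMDiffAt.clm_bundle_apply₂ (F₁ := Model n) (F₂ := Model n) (F₃ := ℝ)
    (E₁ := fun p : M => TangentSpace 𝓘(ℝ, Model n) p)
    (E₂ := fun p : M => TangentSpace 𝓘(ℝ, Model n) p) (E₃ := fun _ : M => ℝ)
    h1 (contMDiffAt_coordVec he hy i) (contMDiffAt_coordVec he hy j)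
  rw [Bundle.contMDiffAt_totalSpace] at h2
  exact h2.2.contDiffAt

theorem comp_symm (e : OpenPartialHomeomorph M (Model n)) (i j : Fin n) (y : Model n) :
    g.comp e i j y = g.comp e j i y :=
  g.symm _ _ _

theorem val_sum_sum (e : OpenPartialHomeomorph M (Model n)) (y : Model n) (v w : Fin n → ℝ) :
    g.val (e.symm y) (∑ i, v i • coordVec e y i) (∑ j, w j • coordVec e y j) =
      ∑ i, ∑ j, g.comp e i j y * w j * v i := by
  simp only [comp, map_sum, map_smul, _root_.sum_apply, _root_.smul_apply,
    smul_eq_mul, Finset.mul_sum]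
  rw [Finset.sum_comm]
  refine Finset.sum_congr rfl fun i _ => Finset.sum_congr rfl fun j _ => by ring

theorem sqNorm_eq (he : e ∈ IsManifold.maximalAtlas 𝓘(ℝ, Model n) ∞ M)
    {y : Model n} (hy : y ∈ e.target) :
    g.sqNorm e X y = g.val (e.symm y) (X (e.symm y)) (X (e.symm y)) := by
  rw [← sum_vecUp_smul_coordVec (X := X) he hy, val_sum_sum]
  simp only [sqNorm, vecDown, Finset.sum_mul]

theorem nondegenerate (p : M) (w : TangentSpace 𝓘(ℝ, Model n) p)
    (h : ∀ u, g.val p u w = 0) : w = 0 := by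
  obtain ⟨b, hb⟩ := g.lorentz p
  beta_reduce at hb
  rw [← b.sum_repr w]
  refine Finset.sum_eq_zero fun i _ => ?_
  have h1 := h (b i)
  rw [← b.sum_repr w, map_sum] at h1
  simp only [map_smul, smul_eq_mul] at h1
  rw [Finset.sum_eq_single i (fun j _ hj => by rw [hb]; simp [hj.symm]) (by simp)] at h1
  have h2 := hb i i
  simp only [if_true] at h2
  rw [h2] at h1
  have : (if (i : ℕ) = 0 then (-1 : ℝ) else 1) ≠ 0 := by split_ifs <;> norm_num
  rw [(mul_eq_zero.1 h1).resolve_right this, zero_smul]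

/-- A kernel vector of the Gram matrix would be the coordinates of a tangent vector orthogonal to
the whole tangent space. -/
theorem det_comp_ne_zero (he : e ∈ IsManifold.maximalAtlas 𝓘(ℝ, Model n) ∞ M)
    {y : Model n} (hy : y ∈ e.target) :
    (Matrix.of fun a b => g.comp e a b y).det ≠ 0 := by
  intro h0
  obtain ⟨v, hv, hv0⟩ := Matrix.exists_mulVec_eq_zero_iff.2 h0
  apply hv
  have hb := (mdifferentiable_of_mem_maximalAtlas he).symm.mfderiv_bijective (x := y) hy
  have key : mfderiv 𝓘(ℝ, Model n) 𝓘(ℝ, Model n) e.symm y (WithLp.toLp 2 v : Model n) = 0 := by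
    apply g.nondegenerate
    intro u
    obtain ⟨u', rfl⟩ := hb.2 u
    change Model n at u'
    have hu : u' = WithLp.toLp 2 (fun i => u' i) := rfl
    rw [hu, ← sum_smul_coordVec, ← sum_smul_coordVec, val_sum_sum]
    refine Finset.sum_eq_zero fun i _ => ?_
    rw [← Finset.sum_mul]
    have := congrFun hv0 i
    simp only [Matrix.mulVec, dotProduct, Matrix.of_apply, Pi.zero_apply] at this
    rw [this, zero_mul]
  have h2 := hb.1 (key.trans (map_zero _).symm)
  funext i
  exact congrArg (fun v : Model n => v i) h2

theorem sum_inv_mul_comp (he : e ∈ IsManifold.maximalAtlas 𝓘(ℝ, Model n) ∞ M)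
    {y : Model n} (hy : y ∈ e.target) (i j : Fin n) :
    ∑ a, g.inv e i a y * g.comp e a j y = if i = j then 1 else 0 := by
  have h := Matrix.nonsing_inv_mul (Matrix.of fun a b => g.comp e a b y)
    (isUnit_iff_ne_zero.2 (g.det_comp_ne_zero he hy))
  have := congrFun (congrFun h i) j
  rwa [Matrix.mul_apply, Matrix.one_apply] at this

theorem inv_symm (e : OpenPartialHomeomorph M (Model n)) (i j : Fin n) (y : Model n) :
    g.inv e i j y = g.inv e j i y := by
  have h : (Matrix.of fun a b => g.comp e a b y).transpose = Matrix.of fun a b => g.comp e a b y :=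
    Matrix.ext fun a b => g.comp_symm e b a y
  unfold inv
  conv_rhs => rw [← h, ← Matrix.transpose_nonsing_inv]
  rfl

theorem contDiffAt_inv (he : e ∈ IsManifold.maximalAtlas 𝓘(ℝ, Model n) ∞ M)
    {y : Model n} (hy : y ∈ e.target) (i j : Fin n) : ContDiffAt ℝ ∞ (g.inv e i j) y := by
  have hdet : ∀ A : Model n → Matrix (Fin n) (Fin n) ℝ,
      (∀ a b, ContDiffAt ℝ ∞ (fun z => A z a b) y) → ContDiffAt ℝ ∞ (fun z => (A z).det) y := by
    intro A hA
    simp only [Matrix.det_apply]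
    refine ContDiffAt.sum fun σ _ => ?_
    simp only [Units.smul_def, zsmul_eq_mul]
    exact contDiffAt_const.mul (contDiffAt_prod fun a _ => hA _ _)
  -- Cramer's rule reduces smoothness of the inverse to that of determinants.
  have h : g.inv e i j = fun z => ((Matrix.of fun a b => g.comp e a b z).det)⁻¹ *
      ((Matrix.of fun a b => g.comp e a b z).updateRow j (Pi.single i 1)).det := by
    funext z
    simp [inv, Matrix.inv_def, Matrix.adjugate_apply]
  rw [h]
  refine ((hdet _ fun a b => g.contDiffAt_comp he hy a b).inv (g.det_comp_ne_zero he hy)).mul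
    (hdet _ fun a b => ?_)
  simp only [Matrix.updateRow_apply]
  split_ifs
  · exact contDiffAt_const
  · exact g.contDiffAt_comp he hy a b

end LorentzMetric
end GRW
end

/-! ### Calculus of partial derivatives. -/

noncomputable section

namespace GRW

section pd

variable {n : ℕ} {f h : Model n → ℝ} {y : Model n}

theorem pd_congr {i : Fin n} (hfh : f =ᶠ[nhds y] h) : pd i f y = pd i h y := by
  unfold pd
  rw [hfh.fderiv_eq]

theorem pd_add (hf : ContDiffAt ℝ ∞ f y) (hh : ContDiffAt ℝ ∞ h y) (i : Fin n) :
    pd i (fun z => f z + h z) y = pd i f y + pd i h y := by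
  unfold pd
  rw [fderiv_fun_add (hf.differentiableAt (by simp)) (hh.differentiableAt (by simp))]
  rfl

theorem pd_mul (hf : ContDiffAt ℝ ∞ f y) (hh : ContDiffAt ℝ ∞ h y) (i : Fin n) :
    pd i (fun z => f z * h z) y = pd i f y * h y + f y * pd i h y := by
  unfold pd
  rw [fderiv_fun_mul (hf.differentiableAt (by simp)) (hh.differentiableAt (by simp))]
  simp
  ring

theorem pd_sum {ι : Type*} {s : Finset ι} {F : ι → Model n → ℝ}
    (hF : ∀ a, ContDiffAt ℝ ∞ (F a) y) (i : Fin n) :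
    pd i (fun z => ∑ a ∈ s, F a z) y = ∑ a ∈ s, pd i (F a) y := by
  unfold pd
  rw [fderiv_fun_sum fun a _ => (hF a).differentiableAt (by simp)]
  simp

theorem pd_sum_mul {F H : Fin n → Model n → ℝ} (hF : ∀ a, ContDiffAt ℝ ∞ (F a) y)
    (hH : ∀ a, ContDiffAt ℝ ∞ (H a) y) (i : Fin n) :
    pd i (fun z => ∑ a, F a z * H a z) y =
      ∑ a, pd i (F a) y * H a y + ∑ a, F a y * pd i (H a) y := by
  rw [pd_sum fun a => (hF a).mul (hH a), ← Finset.sum_add_distrib]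
  exact Finset.sum_congr rfl fun a _ => pd_mul (hF a) (hH a) i

theorem contDiffAt_pd (hf : ContDiffAt ℝ ∞ f y) (i : Fin n) : ContDiffAt ℝ ∞ (pd i f) y :=
  (hf.fderiv_right (m := ∞) (by simp)).clm_apply contDiffAt_const

theorem pd_comm (hf : ContDiffAt ℝ ∞ f y) (i j : Fin n) :
    pd i (pd j f) y = pd j (pd i f) y := by
  have hd : DifferentiableAt ℝ (fderiv ℝ f) y :=
    (hf.fderiv_right (m := ∞) (by simp)).differentiableAt (by simp)
  have key : ∀ a b : Fin n, pd a (pd b f) y =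
      fderiv ℝ (fderiv ℝ f) y (EuclideanSpace.single a 1) (EuclideanSpace.single b 1) := by
    intro a b
    change fderiv ℝ (fun z => fderiv ℝ f z (EuclideanSpace.single b 1)) y _ = _
    rw [fderiv_clm_apply hd (differentiableAt_const _)]
    simp
  rw [key, key]
  exact hf.isSymmSndFDerivAt
    (by simpa using (WithTop.coe_le_coe.2 le_top : ((2 : ℕ∞) : WithTop ℕ∞) ≤ ∞)) _ _

end pd

/-! ### Levi-Civita connection and symmetries of the Riemann tensor. -/

variable {n : ℕ} {M : Type*} [TopologicalSpace M] [ChartedSpace (Model n) M]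
  [IsManifold 𝓘(ℝ, Model n) ∞ M]
  {e : OpenPartialHomeomorph M (Model n)}
  {X : ∀ p : M, TangentSpace 𝓘(ℝ, Model n) p}

namespace LorentzMetric

variable (g : LorentzMetric n M)

theorem contDiffAt_christoffel (he : e ∈ IsManifold.maximalAtlas 𝓘(ℝ, Model n) ∞ M)
    {y : Model n} (hy : y ∈ e.target) (m i j : Fin n) :
    ContDiffAt ℝ ∞ (g.christoffel e m i j) y :=
  contDiffAt_const.mul (ContDiffAt.sum fun a _ => (g.contDiffAt_inv he hy m a).mul
    (((contDiffAt_pd (g.contDiffAt_comp he hy j a) i).add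
      (contDiffAt_pd (g.contDiffAt_comp he hy i a) j)).sub
      (contDiffAt_pd (g.contDiffAt_comp he hy i j) a)))

theorem contDiffAt_vecDown (he : e ∈ IsManifold.maximalAtlas 𝓘(ℝ, Model n) ∞ M)
    (hX : ContMDiff 𝓘(ℝ, Model n) (𝓘(ℝ, Model n).prod 𝓘(ℝ, Model n)) ∞
      (fun p => (⟨p, X p⟩ : TangentBundle 𝓘(ℝ, Model n) M)))
    {y : Model n} (hy : y ∈ e.target) (j : Fin n) :
    ContDiffAt ℝ ∞ (g.vecDown e X j) y :=
  ContDiffAt.sum fun k _ => (g.contDiffAt_comp he hy j k).mul (contDiffAt_vecUp he hX hy k)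

theorem comp_comm (e : OpenPartialHomeomorph M (Model n)) (i j : Fin n) :
    g.comp e i j = g.comp e j i :=
  funext (g.comp_symm e i j)

theorem christoffel_symm (e : OpenPartialHomeomorph M (Model n)) (m i j : Fin n) :
    g.christoffel e m i j = g.christoffel e m j i := by
  funext y
  unfold christoffel
  rw [g.comp_comm e i j]
  simp only [add_comm]

theorem sum_christoffel_mul_comp (he : e ∈ IsManifold.maximalAtlas 𝓘(ℝ, Model n) ∞ M)
    {y : Model n} (hy : y ∈ e.target) (i j l : Fin n) :
    ∑ a, g.christoffel e a i j y * g.comp e a l y =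
      1 / 2 * (pd i (g.comp e j l) y + pd j (g.comp e i l) y - pd l (g.comp e i j) y) := by
  have h : ∀ b, ∑ a, g.inv e a b y * g.comp e a l y = if b = l then 1 else 0 := fun b => by
    rw [← g.sum_inv_mul_comp he hy b l]
    exact Finset.sum_congr rfl fun a _ => by rw [g.inv_symm]
  simp only [christoffel, Finset.mul_sum, Finset.sum_mul]
  rw [Finset.sum_comm]
  rw [Finset.sum_eq_single l]
  · rw [← Finset.sum_congr rfl fun a _ => show g.inv e a l y * g.comp e a l y *
      (1 / 2 * (pd i (g.comp e j l) y + pd j (g.comp e i l) y - pd l (g.comp e i j) y)) = _ by ring,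
      ← Finset.sum_mul, h]
    simp
  · intro b _ hb
    rw [← Finset.sum_congr rfl fun a _ => show g.inv e a b y * g.comp e a l y *
      (1 / 2 * (pd i (g.comp e j b) y + pd j (g.comp e i b) y - pd b (g.comp e i j) y)) = _ by ring,
      ← Finset.sum_mul, h, if_neg hb, zero_mul]
  · simp

/-- The Levi-Civita connection is metric. -/
theorem pd_comp (he : e ∈ IsManifold.maximalAtlas 𝓘(ℝ, Model n) ∞ M)
    {y : Model n} (hy : y ∈ e.target) (k i j : Fin n) :
    pd k (g.comp e i j) y = ∑ a, g.christoffel e a k i y * g.comp e a j y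
      + ∑ a, g.christoffel e a k j y * g.comp e a i y := by
  rw [g.sum_christoffel_mul_comp he hy, g.sum_christoffel_mul_comp he hy, g.comp_comm e j i]
  ring

/-- Metric compatibility applied twice. In each bracket the first two sums are those of
`riemann_eq`; the third is a mixed product `ΓΓg`. -/
theorem pd_pd_comp (he : e ∈ IsManifold.maximalAtlas 𝓘(ℝ, Model n) ∞ M)
    {y : Model n} (hy : y ∈ e.target) (i j k l : Fin n) :
    pd i (pd j (g.comp e k l)) y =
      (∑ a, pd i (g.christoffel e a j k) y * g.comp e a l y
        + (∑ a, ∑ b, g.christoffel e a j k y * (g.christoffel e b i a y * g.comp e b l y)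
        + ∑ a, ∑ b, g.christoffel e a j k y * (g.christoffel e b i l y * g.comp e b a y)))
      + (∑ a, pd i (g.christoffel e a j l) y * g.comp e a k y
        + (∑ a, ∑ b, g.christoffel e a j l y * (g.christoffel e b i a y * g.comp e b k y)
        + ∑ a, ∑ b, g.christoffel e a j l y * (g.christoffel e b i k y * g.comp e b a y))) := by
  have h1 : pd j (g.comp e k l) =ᶠ[nhds y] fun z =>
      ∑ a, g.christoffel e a j k z * g.comp e a l z
        + ∑ a, g.christoffel e a j l z * g.comp e a k z := by
    filter_upwards [e.open_target.mem_nhds hy] with z hz using g.pd_comp he hz j k l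
  have hG := g.contDiffAt_comp he hy
  have hC := g.contDiffAt_christoffel he hy
  rw [pd_congr h1, pd_add (ContDiffAt.sum fun a _ => (hC _ _ _).mul (hG _ _))
    (ContDiffAt.sum fun a _ => (hC _ _ _).mul (hG _ _)),
    pd_sum_mul (fun a => hC _ _ _) (fun a => hG _ _),
    pd_sum_mul (fun a => hC _ _ _) (fun a => hG _ _)]
  simp only [g.pd_comp he hy i, mul_add, Finset.sum_add_distrib, Finset.mul_sum]

theorem riemann_eq (e : OpenPartialHomeomorph M (Model n)) (i j k l : Fin n) (y : Model n) :
    g.riemann e i j k l y =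
      (∑ a, pd j (g.christoffel e a i k) y * g.comp e a l y
        + ∑ a, ∑ b, g.christoffel e a i k y * (g.christoffel e b j a y * g.comp e b l y))
      - (∑ a, pd i (g.christoffel e a j k) y * g.comp e a l y
        + ∑ a, ∑ b, g.christoffel e a j k y * (g.christoffel e b i a y * g.comp e b l y)) := by
  rw [Finset.sum_comm (f := fun a b => g.christoffel e a i k y * _),
    Finset.sum_comm (f := fun a b => g.christoffel e a j k y * _)]
  simp only [riemann, riemannUp, add_mul, sub_mul, Finset.sum_mul, Finset.sum_add_distrib,
    Finset.sum_sub_distrib, mul_assoc]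
  ring

/-- `∂ᵢ∂ⱼgₖₗ - ∂ⱼ∂ᵢgₖₗ = 0` says that `Rᵢⱼₖₗ + Rᵢⱼₗₖ` vanishes; by `hE` the mixed products are
symmetric in `i, j` and cancel. -/
theorem riemann_antisymm_right (he : e ∈ IsManifold.maximalAtlas 𝓘(ℝ, Model n) ∞ M)
    {y : Model n} (hy : y ∈ e.target) (i j k l : Fin n) :
    g.riemann e i j k l y = -g.riemann e i j l k y := by
  have hE : ∀ i j k l : Fin n,
      ∑ a, ∑ b, g.christoffel e a j k y * (g.christoffel e b i l y * g.comp e b a y) =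
      ∑ a, ∑ b, g.christoffel e a i l y * (g.christoffel e b j k y * g.comp e b a y) := by
    intro i j k l
    rw [Finset.sum_comm]
    refine Finset.sum_congr rfl fun a _ => Finset.sum_congr rfl fun b _ => ?_
    rw [g.comp_symm e a b]
    ring
  have h := pd_comm (g.contDiffAt_comp he hy k l) i j
  rw [g.pd_pd_comp he hy, g.pd_pd_comp he hy] at h
  rw [g.riemann_eq, g.riemann_eq]
  linarith [hE i j k l, hE i j l k]

theorem riemann_antisymm_left (e : OpenPartialHomeomorph M (Model n)) (i j k l : Fin n)
    (y : Model n) : g.riemann e i j k l y = -g.riemann e j i k l y := by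
  rw [g.riemann_eq, g.riemann_eq]
  ring

/-- The first Bianchi identity. -/
theorem riemann_bianchi (e : OpenPartialHomeomorph M (Model n)) (i j k l : Fin n) (y : Model n) :
    g.riemann e i j k l y + g.riemann e j k i l y + g.riemann e k i j l y = 0 := by
  simp only [g.riemann_eq]
  simp only [fun m => g.christoffel_symm e m j i, fun m => g.christoffel_symm e m k j,
    fun m => g.christoffel_symm e m k i]
  ring

/-- The classical combination of four Bianchi identities, reduced by the two antisymmetries. -/
theorem riemann_pair_symm (he : e ∈ IsManifold.maximalAtlas 𝓘(ℝ, Model n) ∞ M)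
    {y : Model n} (hy : y ∈ e.target) (i j k l : Fin n) :
    g.riemann e i j k l y = g.riemann e k l i j y := by
  have hr := g.riemann_antisymm_right he hy
  have hl := fun i j k l => g.riemann_antisymm_left e i j k l y
  have hb := fun i j k l => g.riemann_bianchi e i j k l y
  linarith [hb i j k l, hb j k l i, hb k l i j, hb l i j k,
    hr i j k l, hr j k i l, hr k i j l, hr j k l i, hr k l j i, hr l j k i, hr k l i j,
    hr l i k j, hr i k l j, hr l i j k, hr i j l k, hr j l i k,
    hl i k j l, hl l j k i, hl i k l j, hl j l i k, hl l i j k, hl l i k j]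

theorem ricci_symm (he : e ∈ IsManifold.maximalAtlas 𝓘(ℝ, Model n) ∞ M)
    {y : Model n} (hy : y ∈ e.target) (k l : Fin n) : g.ricci e k l y = g.ricci e l k y := by
  unfold ricci
  rw [Finset.sum_comm]
  refine congrArg _ (Finset.sum_congr rfl fun j _ => Finset.sum_congr rfl fun m _ => ?_)
  rw [g.inv_symm e m j, g.riemann_pair_symm he hy, g.riemann_antisymm_left e,
    g.riemann_antisymm_right he hy, neg_neg]

end LorentzMetric
end GRW
end

/-! ### Curvature contracted with a Chen vector. -/

noncomputable section

namespace GRW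

variable {n : ℕ} {M : Type*} [TopologicalSpace M] [ChartedSpace (Model n) M]
  [IsManifold 𝓘(ℝ, Model n) ∞ M]
  {e : OpenPartialHomeomorph M (Model n)}
  {X : ∀ p : M, TangentSpace 𝓘(ℝ, Model n) p}

namespace LorentzMetric

variable {g : LorentzMetric n M}

theorem sum_riemann_mul_vecUp (i j k : Fin n) (y : Model n) :
    ∑ m, g.riemann e i j k m y * vecUp e X m y =
      ∑ a, g.riemannUp e i j k a y * g.vecDown e X a y := by
  simp only [riemann, vecDown, Finset.sum_mul, Finset.mul_sum]
  rw [Finset.sum_comm]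
  simp only [mul_assoc]

theorem sum_comp_mul_vecUp (j : Fin n) (y : Model n) :
    ∑ k, g.comp e j k y * vecUp e X k y = g.vecDown e X j y :=
  rfl

theorem sum_comp_mul_vecUp' (j : Fin n) (y : Model n) :
    ∑ k, g.comp e k j y * vecUp e X k y = g.vecDown e X j y := by
  simp only [g.comp_symm e _ j, sum_comp_mul_vecUp]

theorem sum_riemannUp_mul_vecDown (e : OpenPartialHomeomorph M (Model n)) (i j k : Fin n)
    (y : Model n) (V : Fin n → ℝ) :
    ∑ m, g.riemannUp e i j k m y * V m =
      (∑ m, pd j (g.christoffel e m i k) y * V m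
        + ∑ m, ∑ a, g.christoffel e m i k y * (g.christoffel e a j m y * V a))
      - (∑ m, pd i (g.christoffel e m j k) y * V m
        + ∑ m, ∑ a, g.christoffel e m j k y * (g.christoffel e a i m y * V a)) := by
  rw [Finset.sum_comm (f := fun m a => g.christoffel e m i k y * _),
    Finset.sum_comm (f := fun m a => g.christoffel e m j k y * _)]
  simp only [riemannUp, add_mul, sub_mul, Finset.sum_mul, Finset.sum_add_distrib,
    Finset.sum_sub_distrib, mul_assoc]
  ring

/-- The Ricci identity for a concircular covector field. -/
theorem sum_riemann_mul_vecUp_of_concircular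
    (he : e ∈ IsManifold.maximalAtlas 𝓘(ℝ, Model n) ∞ M)
    (hX : ContMDiff 𝓘(ℝ, Model n) (𝓘(ℝ, Model n).prod 𝓘(ℝ, Model n)) ∞
      (fun p => (⟨p, X p⟩ : TangentBundle 𝓘(ℝ, Model n) M)))
    {r : Model n → ℝ} {y : Model n} (hy : y ∈ e.target) (hr : ContDiffAt ℝ ∞ r y)
    (h : ∀ z ∈ e.target, ∀ j k : Fin n, g.covDeriv e X j k z = r z * g.comp e j k z)
    (i j k : Fin n) :
    ∑ m, g.riemann e i j k m y * vecUp e X m y =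
      pd i r y * g.comp e j k y - pd j r y * g.comp e i k y := by
  have hG := g.contDiffAt_comp he hy
  have hC := g.contDiffAt_christoffel he hy
  have hV := g.contDiffAt_vecDown he hX hy
  have h1 : ∀ z ∈ e.target, ∀ j k : Fin n, pd j (g.vecDown e X k) z =
      ∑ m, g.christoffel e m j k z * g.vecDown e X m z + r z * g.comp e j k z :=
    fun z hz j k => by rw [← h z hz, covDeriv]; ring
  have h2 : ∀ i j : Fin n, pd i (pd j (g.vecDown e X k)) y =
      ∑ m, pd i (g.christoffel e m j k) y * g.vecDown e X m y
        + (∑ m, ∑ a, g.christoffel e m j k y * (g.christoffel e a i m y * g.vecDown e X a y)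
        + r y * ∑ m, g.christoffel e m j k y * g.comp e m i y)
        + (pd i r y * g.comp e j k y
          + r y * (∑ a, g.christoffel e a i j y * g.comp e a k y
            + ∑ a, g.christoffel e a i k y * g.comp e a j y)) := by
    intro i j
    have h3 : pd j (g.vecDown e X k) =ᶠ[nhds y] fun z =>
        ∑ m, g.christoffel e m j k z * g.vecDown e X m z + r z * g.comp e j k z := by
      filter_upwards [e.open_target.mem_nhds hy] with z hz using h1 z hz j k
    rw [pd_congr h3, pd_add (ContDiffAt.sum fun a _ => (hC _ _ _).mul (hV _)) (hr.mul (hG _ _)),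
      pd_sum_mul (fun a => hC _ _ _) (fun a => hV _), pd_mul hr (hG _ _), g.pd_comp he hy]
    simp only [h1 y hy, mul_add, Finset.sum_add_distrib, Finset.mul_sum]
    congr 3
    refine Finset.sum_congr rfl fun a _ => ?_
    rw [g.comp_symm e a i]
    ring
  have h4 := pd_comm (hV k) i j
  rw [h2, h2] at h4
  rw [sum_riemann_mul_vecUp, sum_riemannUp_mul_vecDown]
  -- Torsion-freeness makes the terms with undifferentiated `r` symmetric in `i, j`, so only
  -- curvature and `∂r` survive.
  simp only [fun m => g.christoffel_symm e m j i] at h4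
  linarith

theorem IsChenVector.exists_sum_riemann_mul_vecUp (hX : g.IsChenVector X)
    (he : e ∈ IsManifold.maximalAtlas 𝓘(ℝ, Model n) ∞ M)
    {y : Model n} (hy : y ∈ e.target) :
    ∃ c : ℝ, ∀ i j k : Fin n, ∑ m, g.riemann e i j k m y * vecUp e X m y =
      c * (g.vecDown e X i y * g.comp e j k y - g.vecDown e X j y * g.comp e i k y) := by
  obtain ⟨ρ, hρ, hcov⟩ := hX.concircular
  have hN : g.sqNorm e X y ≠ 0 := by
    rw [g.sqNorm_eq he hy]
    exact (hX.timelike _).ne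
  have hr : ContDiffAt ℝ ∞ (ρ ∘ e.symm) y := (hρ.contMDiffAt.comp y
    ((contMDiffOn_symm_of_mem_maximalAtlas he).contMDiffAt (e.open_target.mem_nhds hy))).contDiffAt
  have h1 := sum_riemann_mul_vecUp_of_concircular he hX.contMDiff hy hr (hcov e he)
  set d : Fin n → ℝ := fun i => pd i (ρ ∘ e.symm) y
  have h2 : ∀ i j, d i * g.vecDown e X j y = d j * g.vecDown e X i y := by
    intro i j
    -- Antisymmetry of `Rᵢⱼₖₘ` in `k, m` against the symmetric `XᵏXᵐ`.
    have h3 : ∑ k, (∑ m, g.riemann e i j k m y * vecUp e X m y) * vecUp e X k y = 0 := by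
      have : ∑ k, (∑ m, g.riemann e i j k m y * vecUp e X m y) * vecUp e X k y =
          -∑ k, (∑ m, g.riemann e i j k m y * vecUp e X m y) * vecUp e X k y := by
        simp only [Finset.sum_mul]
        conv_lhs => rw [Finset.sum_comm]
        simp only [← Finset.sum_neg_distrib]
        refine Finset.sum_congr rfl fun k _ => Finset.sum_congr rfl fun m _ => ?_
        rw [g.riemann_antisymm_right he hy]
        ring
      linarith
    simp only [h1, sub_mul, mul_assoc, Finset.sum_sub_distrib, ← Finset.mul_sum,
      sum_comp_mul_vecUp] at h3
    linarith
  -- The constant comes from contracting `dᵢXⱼ = dⱼXᵢ` with `Xʲ` and dividing by `X² ≠ 0`.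
  refine ⟨(∑ j, d j * vecUp e X j y) / g.sqNorm e X y, fun i j k => ?_⟩
  have h4 : ∀ i, d i = (∑ j, d j * vecUp e X j y) / g.sqNorm e X y * g.vecDown e X i y := by
    intro i
    rw [div_mul_eq_mul_div, eq_div_iff hN, sqNorm, Finset.mul_sum, Finset.sum_mul]
    refine Finset.sum_congr rfl fun j _ => ?_
    rw [← mul_assoc, h2]
    ring
  rw [h1]
  change d i * _ - d j * _ = _
  rw [h4 i, h4 j]
  ring

/-- Trace of `hc`: the first term contributes `cXₖ`, the second `-ncXₖ`. -/
theorem sum_ricci_mul_vecUp (he : e ∈ IsManifold.maximalAtlas 𝓘(ℝ, Model n) ∞ M)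
    {y : Model n} (hy : y ∈ e.target) {c : ℝ}
    (hc : ∀ i j k : Fin n, ∑ m, g.riemann e i j k m y * vecUp e X m y =
      c * (g.vecDown e X i y * g.comp e j k y - g.vecDown e X j y * g.comp e i k y)) (k : Fin n) :
    ∑ l, g.ricci e k l y * vecUp e X l y = c * (1 - n) * g.vecDown e X k y := by
  have h1 : ∑ l, g.ricci e k l y * vecUp e X l y =
      ∑ j, ∑ m, g.inv e j m y * ∑ l, g.riemann e j k m l y * vecUp e X l y := by
    simp only [ricci, ← Finset.sum_neg_distrib, Finset.sum_mul, Finset.mul_sum]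
    rw [Finset.sum_comm]
    refine Finset.sum_congr rfl fun j _ => ?_
    rw [Finset.sum_comm]
    refine Finset.sum_congr rfl fun m _ => Finset.sum_congr rfl fun l _ => ?_
    rw [g.riemann_antisymm_right he hy]
    ring
  have h2 : ∀ j k, ∑ m, g.inv e j m y * g.comp e k m y = if j = k then 1 else 0 := fun j k => by
    simp only [g.comp_symm e k, g.sum_inv_mul_comp he hy]
  have h3 : ∀ j, ∑ m, g.inv e j m y *
      (c * (g.vecDown e X j y * g.comp e k m y - g.vecDown e X k y * g.comp e j m y)) =
      c * (g.vecDown e X j y * (if j = k then 1 else 0) - g.vecDown e X k y) := by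
    intro j
    calc _ = c * (g.vecDown e X j y * ∑ m, g.inv e j m y * g.comp e k m y
          - g.vecDown e X k y * ∑ m, g.inv e j m y * g.comp e j m y) := by
          simp only [Finset.mul_sum, ← Finset.sum_sub_distrib]
          exact Finset.sum_congr rfl fun m _ => by ring
      _ = _ := by rw [h2, h2, if_pos rfl, mul_one]
  simp only [h1, hc, h3, ← Finset.mul_sum, Finset.sum_sub_distrib]
  simp
  ring

/-- The Weyl tensor contracted with `X` is `Xⱼ Sₖₗ - Xₖ Sⱼₗ`, where `X` is an eigenvector of the
symmetric form `S`. -/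
theorem IsChenVector.exists_weylX_eq (hn : 3 ≤ n) (hX : g.IsChenVector X)
    (he : e ∈ IsManifold.maximalAtlas 𝓘(ℝ, Model n) ∞ M)
    {y : Model n} (hy : y ∈ e.target) :
    ∃ (S : Fin n → Fin n → ℝ) (s : ℝ),
      (∀ j k l, g.weylX e X j k l y = g.vecDown e X j y * S k l - g.vecDown e X k y * S j l) ∧
      ∀ k, ∑ a, S a k * vecUp e X a y = s * g.vecDown e X k y := by
  obtain ⟨c, hc⟩ := hX.exists_sum_riemann_mul_vecUp he hy
  have hR := g.sum_ricci_mul_vecUp he hy hc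
  have hn' : (3 : ℝ) ≤ n := by exact_mod_cast hn
  have hn2 : (n : ℝ) - 2 ≠ 0 := by linarith
  have hn1 : (n : ℝ) - 1 ≠ 0 := by linarith
  -- The coefficient of `Xⱼgₖₗ`: Riemann and Ricci give `c + c(1 - n)/(n - 2) = -c/(n - 2)`, and the
  -- scalar term adds the rest.
  set μ : ℝ := -c / (n - 2) - g.scalar e y / ((n - 1) * (n - 2)) with hμ
  refine ⟨fun k l => 1 / ((n : ℝ) - 2) * g.ricci e k l y + μ * g.comp e k l y,
    1 / ((n : ℝ) - 2) * (c * (1 - n)) + μ, fun j k l => ?_, fun k => ?_⟩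
  · have h1 : g.weylX e X j k l y =
        ∑ m, g.riemann e j k l m y * vecUp e X m y
        + 1 / ((n : ℝ) - 2) * (
          g.ricci e k l y * ∑ m, g.comp e j m y * vecUp e X m y
          - g.ricci e j l y * ∑ m, g.comp e k m y * vecUp e X m y
          + g.comp e k l y * ∑ m, g.ricci e j m y * vecUp e X m y
          - g.comp e j l y * ∑ m, g.ricci e k m y * vecUp e X m y)
        - g.scalar e y / ((n - 1) * (n - 2)) *
          (g.comp e k l y * ∑ m, g.comp e j m y * vecUp e X m y
            - g.comp e j l y * ∑ m, g.comp e k m y * vecUp e X m y) := by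
      simp only [weylX, weyl, Finset.mul_sum, ← Finset.sum_add_distrib, ← Finset.sum_sub_distrib]
      exact Finset.sum_congr rfl fun m _ => by ring
    rw [h1]
    simp only [hc, hR, sum_comp_mul_vecUp, hμ]
    field_simp
    ring
  -- `hR` contracts the second Ricci index, hence the appeal to `ricci_symm`.
  · simp only [add_mul, Finset.sum_add_distrib, mul_assoc, ← Finset.mul_sum, sum_comp_mul_vecUp',
      g.ricci_symm he hy _ k, hR]

theorem contractedWeyl_eq (e : OpenPartialHomeomorph M (Model n))
    (X : ∀ p : M, TangentSpace 𝓘(ℝ, Model n) p) (j k : Fin n) (y : Model n) :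
    g.contractedWeyl e X j k y =
      ∑ a, g.weylX e X a j k y * (vecUp e X a y / g.sqNorm e X y) := by
  simp only [contractedWeyl, weylX, Finset.sum_mul]
  exact Finset.sum_congr rfl fun a _ => Finset.sum_congr rfl fun b _ => by ring

end LorentzMetric

end GRW

end

theorem mainTheorem5 {n : ℕ} (hn : 3 ≤ n) {M : Type*} [TopologicalSpace M]
    [ChartedSpace (GRW.Model n) M] [IsManifold 𝓘(ℝ, GRW.Model n) ∞ M]
    (g : GRW.LorentzMetric n M) (X : ∀ p : M, TangentSpace 𝓘(ℝ, GRW.Model n) p)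
    (hX : g.IsChenVector X)
    (e : OpenPartialHomeomorph M (GRW.Model n))
    (he : e ∈ IsManifold.maximalAtlas 𝓘(ℝ, GRW.Model n) ∞ M)
    (y : GRW.Model n) (hy : y ∈ e.target) :
    (∀ j k l : Fin n, g.weylX e X j k l y =
      g.vecDown e X j y * g.contractedWeyl e X k l y
        - g.vecDown e X k y * g.contractedWeyl e X j l y) ∧
    ((∀ j k l : Fin n, g.weylX e X j k l y = 0) ↔
      ∀ k l : Fin n, g.contractedWeyl e X k l y = 0) := by
  have main : ∀ j k l : Fin n, g.weylX e X j k l y =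
      g.vecDown e X j y * g.contractedWeyl e X k l y
        - g.vecDown e X k y * g.contractedWeyl e X j l y := by
    obtain ⟨S, s, hS, hs⟩ := hX.exists_weylX_eq hn he hy
    have hN : g.sqNorm e X y ≠ 0 := by
      rw [g.sqNorm_eq he hy]
      exact (hX.timelike _).ne
    have hC : ∀ k l, g.contractedWeyl e X k l y =
        S k l - g.vecDown e X k y * (s * g.vecDown e X l y) / g.sqNorm e X y := by
      intro k l
      have h1 : g.contractedWeyl e X k l y = (S k l *
          (∑ a, g.vecDown e X a y * GRW.vecUp e X a y)
          - g.vecDown e X k y * ∑ a, S a l * GRW.vecUp e X a y) / g.sqNorm e X y := by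
        rw [GRW.LorentzMetric.contractedWeyl_eq]
        simp only [hS, Finset.mul_sum, ← Finset.sum_sub_distrib, Finset.sum_div]
        exact Finset.sum_congr rfl fun a _ => by ring
      rw [h1, hs]
      change (S k l * g.sqNorm e X y - _) / _ = _
      field_simp
    intro j k l
    -- The corrections are multiples of `XⱼXₖXₗ` and cancel in the difference.
    rw [hS, hC, hC]
    ring
  refine ⟨main, fun h k l => ?_, fun h j k l => ?_⟩
  · rw [GRW.LorentzMetric.contractedWeyl_eq]
    simp [h]
  · simp [main, h]
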